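/- Let $d\in\mathbb N$ and $\varsigma>s>d/2$. Write $\widehat f(\xi)=\int_{\mathbb R^d} f(x)e^{-ix\cdot\xi}\,dx$ (extended to $L^2$), $\|f\|_{H^t}=(2\pi)^{-d/2}\big(\int|\widehat f(\xi)|^2(1+\|\xi\|_2^2)^t\,d\xi\big)^{1/2}$, $H^t=\{f:\|f\|_{H^t}<\infty\}$ and $\nu_2(f)=\sup\{t: f\in H^t\}$; functions in $H^t$ with $t>d/2$ that are sampled are taken to be continuous. **Refinable function.** Let $\phi:\mathbb R^d\to[0,\infty)$ be compactly supported with $\nu_2(\phi)>\varsigma$, and refinable: $\widehat\phi(2\xi)=\widehat a(\xi)\widehat\phi(\xi)$ with $\widehat a$ a $2\pi\mathbb Z^d$-periodic function and $\widehat\phi(0)=1$. Suppose that $\widehat a$ has $\kappa+1$ sum rules for some $\kappa\in\mathbb N_0$ with $\kappa+1>\varsigma$, i.e. $\widehat a(\xi+2\pi\beta)=O(\|\xi\|_2^{\kappa+1})$ as $\xi\to0$ for every $\beta\in 2^{-1}\mathbb Z^d\setminus\mathbb Z^d$. **Region and sampling sets.** Let $\Omega\subset\mathbb R^d$ be bounded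 with $\Omega\cap\mathbb Z^d\ne\emptyset$; put $L_{l,\min}=\min\{k_l:k\in\Omega\cap\mathbb Z^d\}$, $L_{l,\max}=\max\{k_l:k\in\Omega\cap\mathbb Z^d\}$, and assume $\Omega\subseteq\prod_{l=1}^d[L_{l,\min},L_{l,\max}]$. Let $\operatorname{supp}\phi\subseteq\prod_{l=1}^d[0,M_l]$, fix $j_0\in\{1,\dots,d\}$, and for $N\ge1$ let $$\Lambda_{\Omega,N}=\{k\in\mathbb Z^d: 2^NL_{l,\min}-M_l\le k_l\le 2^NL_{l,\max},\ l=1,\dots,d\},\qquad \Xi_{\Omega,N}=\{(k,k',k''):k\in\Lambda_{\Omega,N},\ k'=k+e_{j_0},\ k''=k-e_{j_0}\}.$$ **Reference waves.** Let $g_N(x)=a_Ne^{i\mathcal K_N\cdot x}$, $a_N>0$, $\mathcal K_N\in\mathbb R^d$, $N\ge1$, be plane waves that are uniformly $\gamma$-admissible on $\{\Xi_{\Omega,N}\}$ ($0<\gamma<\infty$): with $\mu_{N;k,k',k''}=-\Im\big[(g_N(2^{-N}k)-g_N(2^{-N}k'))(\overline{g_N}(2^{-N}k)-\overline{g_N}(2^{-N}k''))\big]$,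 for all $N\ge1$ and $(k,k',k'')\in\Xi_{\Omega,N}$ one has $g_N(2^{-N}k)\ne g_N(2^{-N}k')$, $g_N(2^{-N}k)\ne g_N(2^{-N}k'')$, $\mu_{N;k,k',k''}\neq0$ and $$\frac{\max\{|g_N(2^{-N}k)-g_N(2^{-N}k')|,\ |\overline{g_N}(2^{-N}k)-\overline{g_N}(2^{-N}k'')|\}}{|\mu_{N;k,k',k''}|}\le\gamma,$$ and the numbers $|g_N(2^{-N}k)|,|g_N(2^{-N}k')|,|g_N(2^{-N}k'')|$ are bounded uniformly in $N$ and $(k,k',k'')$. **Samples.** For $f:\mathbb R^d\to\mathbb C$ let $I_{N,q}=|f(2^{-N}q)+g_N(2^{-N}q)|^2$ and, for $k\in\Lambda_{\Omega,N}$, let $\mathring f(2^{-N}k)$ be the complex number whose real and imaginary parts are the entries of $$\frac1{2\mu_{N;k,k',k''}}\begin{bmatrix}e&-\delta\\-h&c\end{bmatrix}\begin{bmatrix}I_{N,k}-I_{N,k'}\\I_{N,k}-I_{N,k''}\end{bmatrix},\qquad c+i\delta=g_N(2^{-N}k)-g_N(2^{-N}k'),\quad h+ie=g_N(2^{-N}k)-g_N(2^{-N}k'').$$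 **Theorem.** There exist $C>0$, depending only on $s,\varsigma,\phi$ (and $d$), and $C_1>0$, depending only on $s,\varsigma,\phi,\Omega$ (and $d$), such that for all $M_l$, $j_0$, $\gamma$ and $(g_N)$ as above, every $f\in H^\varsigma(\mathbb R^d)$ and every $N\ge1$, $$\Big\|f-\sum_{k\in\Lambda_{\Omega,N}}\mathring f(2^{-N}k)\,\phi(2^N\cdot-k)\Big\|_{L^2(\Omega)}\le\|f\|_{H^\varsigma}\Big[C\,2^{-N(\varsigma-s)/2}+\gamma\,C_1\Big(\|f\|_{H^\varsigma}+\sup_{l\ge1}\sup_{x\in\Omega}|g_l(x)|\Big)2^{-(N+1)\zeta}\Big],$$ where $\zeta=\min\{1,\varsigma-s\}$. -/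

import Mathlib

open MeasureTheory FourierTransform
open scoped ENNReal Topology

noncomputable section

namespace SingleShot

/-- `ℝ^d` with the Euclidean norm and inner product. -/
abbrev Space (d : ℕ) : Type := EuclideanSpace ℝ (Fin d)

/-- An integer vector, seen as a point of `ℝ^d`. -/
def latticePt {d : ℕ} (k : Fin d → ℤ) : Space d := WithLp.toLp 2 (fun i => (k i : ℝ))

/-! ### Fourier transform and Sobolev spaces -/

/-- The Fourier transform `ξ ↦ ∫ f(x) e^{-i x·ξ} dx` of an integrable function. -/
def fourierHat {d : ℕ} (f : Space d → ℂ) (ξ : Space d) : ℂ :=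
  ∫ x, f x * Complex.exp (-(Complex.I * ((inner ℝ x ξ : ℝ) : ℂ)))

open Classical in
/-- The Fourier(-Plancherel) transform of an `L²` function, in the normalization
`ξ ↦ ∫ f(x) e^{-i x·ξ} dx`. The transform `𝓕` of Mathlib has the kernel `e^{-2πi x·η}`,
whence the rescaling `η = ξ / (2π)`. -/
def fourierHatL2 {d : ℕ} (f : Space d → ℂ) : Space d → ℂ :=
  if hf : MemLp f 2 (volume : Measure (Space d)) then
    fun ξ => (𝓕 (hf.toLp f) : Lp (α := Space d) ℂ 2 volume) ((2 * Real.pi)⁻¹ • ξ)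
  else 0

/-- `∫ |f^(ξ)|² (1 + ‖ξ‖²)^s dξ`, as an extended nonnegative number. -/
def sobolevEnergy {d : ℕ} (s : ℝ) (f : Space d → ℂ) : ℝ≥0∞ :=
  ∫⁻ ξ, ENNReal.ofReal (‖fourierHatL2 f ξ‖ ^ 2 * (1 + ‖ξ‖ ^ 2) ^ s)

/-- Membership of an `L²` function in `H^s(ℝ^d)`. For `s ≥ 0` this is all of `H^s(ℝ^d)`. -/
def MemSobolev {d : ℕ} (s : ℝ) (f : Space d → ℂ) : Prop :=
  MemLp f 2 (volume : Measure (Space d)) ∧ sobolevEnergy s f < ∞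

/-- The norm `(2π)^{-d/2} (∫ |f^(ξ)|² (1 + ‖ξ‖²)^s dξ)^{1/2}` of `H^s(ℝ^d)`. -/
def sobolevNorm {d : ℕ} (s : ℝ) (f : Space d → ℂ) : ℝ :=
  (2 * Real.pi) ^ (-((d : ℝ) / 2)) * Real.sqrt (sobolevEnergy s f).toReal

/-- The Sobolev smoothness exponent `ν₂(f) = sup {s | f ∈ H^s(ℝ^d)}`, which may be `+∞`. -/
def smoothnessExponent {d : ℕ} (f : Space d → ℂ) : EReal :=
  sSup ((fun s : ℝ => (s : EReal)) '' {s : ℝ | MemSobolev s f})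

/-! ### Refinable functions -/

/-- `φ` is refinable with mask symbol `a`: `a` is `2πℤ^d`-periodic,
`φ^(2ξ) = a(ξ) φ^(ξ)`, and `φ` is normalized by `φ^(0) = 1`. -/
structure IsRefinable {d : ℕ} (φ : Space d → ℂ) (a : Space d → ℂ) : Prop where
  periodic : ∀ (ξ : Space d) (k : Fin d → ℤ), a (ξ + (2 * Real.pi) • latticePt k) = a ξ
  refinement : ∀ ξ : Space d, fourierHat φ ((2 : ℝ) • ξ) = a ξ * fourierHat φ ξ
  normalized : fourierHat φ 0 = 1

/-- The mask symbol `a` has `m` sum rules: `a(ξ + 2πγ) = O(‖ξ‖^m)` as `ξ → 0` for every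
`γ ∈ 2⁻¹ℤ^d \ ℤ^d`; such a `γ` is `k / 2` where `k ∈ ℤ^d` has an odd coordinate. -/
def HasSumRules {d : ℕ} (a : Space d → ℂ) (m : ℕ) : Prop :=
  ∀ k : Fin d → ℤ, (∃ i, Odd (k i)) →
    (fun ξ : Space d => a (ξ + (2 * Real.pi) • ((2 : ℝ)⁻¹ • latticePt k)))
      =O[𝓝 0] fun ξ : Space d => ‖ξ‖ ^ m

/-! ### Region of interest and sampling sets -/

/-- The integer points of `Ω`. -/
def intPts {d : ℕ} (Ω : Set (Space d)) : Set (Fin d → ℤ) := {k | latticePt k ∈ Ω}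

/-- The least `l`-th coordinate of the integer points of `Ω`. -/
def Lmin {d : ℕ} (Ω : Set (Space d)) (l : Fin d) : ℤ := sInf ((fun k => k l) '' intPts Ω)

/-- The greatest `l`-th coordinate of the integer points of `Ω`. -/
def Lmax {d : ℕ} (Ω : Set (Space d)) (l : Fin d) : ℤ := sSup ((fun k => k l) '' intPts Ω)

/-- `Λ_{Ω,N}`, the integer points of `∏ₗ [2^N Lₗ,min - Mₗ, 2^N Lₗ,max]`. -/
def Lam {d : ℕ} (Ω : Set (Space d)) (M : Fin d → ℝ) (N : ℕ) : Finset (Fin d → ℤ) :=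
  Fintype.piFinset fun l =>
    Finset.Icc ⌈(2 : ℝ) ^ N * (Lmin Ω l : ℝ) - M l⌉ (2 ^ N * Lmax Ω l)

theorem mem_Lam {d : ℕ} (Ω : Set (Space d)) (M : Fin d → ℝ) (N : ℕ) (k : Fin d → ℤ) :
    k ∈ Lam Ω M N ↔ ∀ l, (2 : ℝ) ^ N * (Lmin Ω l : ℝ) - M l ≤ (k l : ℝ) ∧
      (k l : ℝ) ≤ (2 : ℝ) ^ N * (Lmax Ω l : ℝ) := by
  simp only [Lam, Fintype.mem_piFinset, Finset.mem_Icc, Int.ceil_le]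
  refine forall_congr' fun l => and_congr_right fun _ => ?_
  rw [← Int.cast_le (R := ℝ)]
  push_cast
  rfl

/-- The `j`-th vector of the natural basis. -/
def basisVec {d : ℕ} (j : Fin d) : Space d := EuclideanSpace.single j (1 : ℝ)

/-- `Ξ_{Ω,N}`, the triples `(k, k + e_{j₀}, k - e_{j₀})` with `k ∈ Λ_{Ω,N}`. -/
def Xi {d : ℕ} (Ω : Set (Space d)) (M : Fin d → ℝ) (j₀ : Fin d) (N : ℕ) :
    Set (Space d × Space d × Space d) :=
  {t | ∃ k ∈ Lam Ω M N,
    t = (latticePt k, latticePt k + basisVec j₀, latticePt k - basisVec j₀)}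

/-! ### Reference waves -/

/-- Plane waves `x ↦ a e^{i K·x}` with amplitude `a > 0`. -/
def IsPlaneWave {d : ℕ} (g : Space d → ℂ) : Prop :=
  ∃ a : ℝ, 0 < a ∧ ∃ K : Space d,
    ∀ x, g x = (a : ℂ) * Complex.exp (Complex.I * ((inner ℝ K x : ℝ) : ℂ))

/-- The value `2^{-N} p`. -/
def dilate {d : ℕ} (N : ℕ) (p : Space d) : Space d := ((2 : ℝ) ^ N)⁻¹ • p

/-- `(g(2^{-N}p) - g(2^{-N}p')) · conj (g(2^{-N}p) - g(2^{-N}p''))`. -/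
def diffProduct {d : ℕ} (g : Space d → ℂ) (N : ℕ) (p p' p'' : Space d) : ℂ :=
  (g (dilate N p) - g (dilate N p')) *
    (starRingEnd ℂ (g (dilate N p)) - starRingEnd ℂ (g (dilate N p'')))

/-- `g` is `γ`-admissible on `Ξ` with respect to the level `N`. A quotient with vanishing
denominator counts as infinite, so the denominator is required not to vanish. -/
structure IsAdmissible {d : ℕ} (g : Space d → ℂ) (γ : ℝ)
    (Ξ : Set (Space d × Space d × Space d)) (N : ℕ) : Prop where
  pos : 0 < γ
  ne_fst : ∀ p p' p'', (p, p', p'') ∈ Ξ → g (dilate N p) ≠ g (dilate N p')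
  ne_snd : ∀ p p' p'', (p, p', p'') ∈ Ξ → g (dilate N p) ≠ g (dilate N p'')
  im_ne : ∀ p p' p'', (p, p', p'') ∈ Ξ → (diffProduct g N p p' p'').im ≠ 0
  bound : ∀ p p' p'', (p, p', p'') ∈ Ξ →
    max ‖g (dilate N p) - g (dilate N p')‖
        ‖starRingEnd ℂ (g (dilate N p)) - starRingEnd ℂ (g (dilate N p''))‖
      / |(diffProduct g N p p' p'').im| ≤ γ

/-- The sequence `g 1, g 2, …` is uniformly `γ`-admissible on `Ξ 1, Ξ 2, …`. -/
structure IsUniformlyAdmissible {d : ℕ} (g : ℕ → Space d → ℂ) (γ : ℝ)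
    (Ξ : ℕ → Set (Space d × Space d × Space d)) : Prop where
  admissible : ∀ N, 1 ≤ N → IsAdmissible (g N) γ (Ξ N) N
  bounded : ∃ B : ℝ, ∀ N, 1 ≤ N → ∀ p p' p'', (p, p', p'') ∈ Ξ N →
    ‖g N (dilate N p)‖ ≤ B ∧ ‖g N (dilate N p')‖ ≤ B ∧ ‖g N (dilate N p'')‖ ≤ B

/-- `sup_{l ≥ 1} sup_{x ∈ Ω} |g_l(x)|`. -/
def waveSup {d : ℕ} (g : ℕ → Space d → ℂ) (Ω : Set (Space d)) : ℝ :=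
  sSup {r : ℝ | ∃ l : ℕ, 1 ≤ l ∧ ∃ x ∈ Ω, r = ‖g l x‖}

/-! ### Reconstruction from single-shot intensities -/

/-- The interference intensity `I_{N,p} = |f(2^{-N}p) + g(2^{-N}p)|²`. -/
def intensity {d : ℕ} (f g : Space d → ℂ) (N : ℕ) (p : Space d) : ℝ :=
  ‖f (dilate N p) + g (dilate N p)‖ ^ 2

/-- The approximate sample computed from the plane wave `g` and the three intensities
`I p`, `I (p + e_{j₀})`, `I (p - e_{j₀})`: its real and imaginary parts are the entries of
`(2μ)⁻¹ [[e, -d], [-h, c]] (I p - I p', I p - I p'')ᵀ`. -/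
def planeSample {d : ℕ} (g : Space d → ℂ) (I : Space d → ℝ) (j₀ : Fin d) (N : ℕ)
    (p : Space d) : ℂ :=
  let p' := p + basisVec j₀
  let p'' := p - basisVec j₀
  let c := (g (dilate N p) - g (dilate N p')).re
  let δ := (g (dilate N p) - g (dilate N p')).im
  let h := (g (dilate N p) - g (dilate N p'')).re
  let e := (g (dilate N p) - g (dilate N p'')).im
  let μ := -(diffProduct g N p p' p'').im
  let u := I p - I p'
  let v := I p - I p''
  ⟨(2 * μ)⁻¹ * (e * u - δ * v), (2 * μ)⁻¹ * (-h * u + c * v)⟩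

/-- The reconstruction `x ↦ ∑_{k ∈ Λ_{Ω,N}} f°(2^{-N}k) φ(2^N x - k)`, with the samples `f°`
computed from the intensities of `f` and the plane wave `g`. -/
def reconstruction {d : ℕ} (φ : Space d → ℝ) (Ω : Set (Space d)) (M : Fin d → ℝ) (j₀ : Fin d)
    (g f : Space d → ℂ) (N : ℕ) (x : Space d) : ℂ :=
  ∑ k ∈ Lam Ω M N, planeSample g (intensity f g N) j₀ N (latticePt k) *
    (φ ((2 : ℝ) ^ N • x - latticePt k) : ℂ)

end SingleShot

end

noncomputable section

namespace SingleShot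

/-! The proof is a pointwise estimate, integrated over the bounded set `Ω` at the end. By Sobolev
embedding (`exists_sobolev_embedding`), `f` is bounded and `ζ`-Hölder, both with constant `K
‖f‖_{H^ς}`. The sum rules make the transform of `φ` vanish on `2πℤ^d \ {0}`, so the integer
translates of `φ ≥ 0` sum to one almost everywhere (`ae_tsum_translates_eq_one`). Hence at almost
every point of `Ω` the reconstruction is a convex combination of samples taken at distance
`O(2^{-N})`. A plane wave has constant modulus, so `|g|²` cancels in intensity differences.
Replacing the neighbouring values of `f` by the central one leaves a 2×2 real linear system for the
sample, with Hölder-small residuals; admissibility bounds its inverse (`norm_planeSample_sub_le`).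
Admissibility also forces `1 ≤ 2αγ` for the amplitude `α`, so the whole error fits into the second
term of the bound. -/

/-! ### Fourier inversion and Sobolev embedding. -/

/-- If the `L²` Fourier transform of an `L²` function is integrable, the function is recovered
by the inverse Fourier integral. -/
theorem ae_eq_fourierInv_of_integrable_fourier {d : ℕ} (u : Lp (α := Space d) ℂ 2 volume)
    (hu : Integrable (𝓕 u : Lp (α := Space d) ℂ 2 volume)) :
    (u : Space d → ℂ) =ᵐ[volume] 𝓕⁻ ((𝓕 u : Lp (α := Space d) ℂ 2 volume) : Space d → ℂ) := by
  set G : Lp (α := Space d) ℂ 2 volume := 𝓕 u with hG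
  have hcont : Continuous (𝓕⁻ (G : Space d → ℂ)) := by
    rw [Real.fourierInv_eq_fourier_comp_neg]
    exact VectorFourier.fourierIntegral_continuous Real.continuous_fourierChar
      continuous_inner hu.comp_neg
  -- Both sides are paired with test functions, regarded as Schwartz functions: `h1` moves the
  -- inverse transform by duality of tempered distributions, `h2` moves it back by Fubini.
  refine ae_eq_of_integral_contDiff_smul_eq ((Lp.memLp u).locallyIntegrable (by norm_num))
    hcont.locallyIntegrable fun g hg hgs => ?_
  have hg₁ : HasCompactSupport (Complex.ofRealCLM ∘ g) := hgs.comp_left rfl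
  have hg₂ : ContDiff ℝ (⊤ : ℕ∞) (Complex.ofRealCLM ∘ g) := by fun_prop
  set ψ := hg₁.toSchwartzMap hg₂ with hψ
  have hψg : ∀ x, ψ x = (g x : ℂ) := fun x => rfl
  have huG : 𝓕⁻ G = u := by rw [hG]; exact FourierTransform.fourierInv_fourier_eq u
  have h1 : ∫ x, ψ x • u x = ∫ x, (𝓕⁻ ψ) x • G x := by
    have h := congrArg (fun T => T ψ) (Lp.fourierInv_toTemperedDistribution_eq G)
    rw [huG] at h
    simpa [TemperedDistribution.fourierInv_apply] using h.symm
  have h2 : ∫ x, (𝓕⁻ ψ) x • G x = ∫ x, ψ x • (𝓕⁻ (G : Space d → ℂ)) x := by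
    have h := VectorFourier.integral_fourierIntegral_smul_eq_flip (L := -innerₗ (Space d))
      (μ := volume) (ν := volume)
      Real.continuous_fourierChar (by simpa using (continuous_inner (𝕜 := ℝ) (E := Space d)).fun_neg) ψ.integrable hu
    convert h using 1
    · congr 1; ext x
      simp [SchwartzMap.fourierInv_coe, Real.fourierInv_eq, VectorFourier.fourierIntegral]
    · congr 1; ext x
      simp [Real.fourierInv_eq, VectorFourier.fourierIntegral, real_inner_comm]
  calc ∫ x, g x • u x = ∫ x, ψ x • u x := by simp [hψg]
    _ = _ := h1.trans h2
    _ = _ := by simp [hψg]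

theorem fourierHatL2_of_memLp {d : ℕ} {f : Space d → ℂ} (hf : MemLp f 2 volume) (ξ : Space d) :
    fourierHatL2 f ξ =
      (𝓕 (hf.toLp f) : Lp (α := Space d) ℂ 2 volume) ((2 * Real.pi)⁻¹ • ξ) := by
  simp [fourierHatL2, hf]

theorem stronglyMeasurable_fourierHatL2 {d : ℕ} (f : Space d → ℂ) :
    StronglyMeasurable (fourierHatL2 f) := by
  unfold fourierHatL2
  split_ifs with hf
  · exact (Lp.stronglyMeasurable _).comp_measurable (measurable_const_smul _)
  · exact stronglyMeasurable_zero

theorem memLp_weighted_fourierHatL2 {d : ℕ} {r : ℝ} {f : Space d → ℂ} (hf : MemSobolev r f) :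
    MemLp (fun ξ => ‖fourierHatL2 f ξ‖ * (1 + ‖ξ‖ ^ 2) ^ (r / 2)) 2 volume ∧
      ∫ ξ, (‖fourierHatL2 f ξ‖ * (1 + ‖ξ‖ ^ 2) ^ (r / 2)) ^ 2 = (sobolevEnergy r f).toReal := by
  have hmeas : AEStronglyMeasurable
      (fun ξ => ‖fourierHatL2 f ξ‖ * (1 + ‖ξ‖ ^ 2) ^ (r / 2)) volume :=
    (stronglyMeasurable_fourierHatL2 f).norm.aestronglyMeasurable.mul
      (Continuous.rpow_const (by fun_prop) fun ξ => Or.inl (by positivity)).aestronglyMeasurable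
  have hsq : ∀ ξ : Space d, (‖fourierHatL2 f ξ‖ * (1 + ‖ξ‖ ^ 2) ^ (r / 2)) ^ 2
      = ‖fourierHatL2 f ξ‖ ^ 2 * (1 + ‖ξ‖ ^ 2) ^ r := fun ξ => by
    rw [mul_pow, ← Real.rpow_mul_natCast (by positivity)]
    congr 2
    push_cast
    ring
  constructor
  · refine (memLp_two_iff_integrable_sq hmeas).2 ⟨hmeas.pow 2, ?_⟩
    rw [hasFiniteIntegral_iff_ofReal (Filter.Eventually.of_forall fun ξ => by positivity)]
    simp_rw [hsq]
    exact hf.2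
  · have hm := hmeas.pow 2
    simp_rw [Pi.pow_def, hsq] at hm
    simp_rw [hsq]
    rw [integral_eq_lintegral_of_nonneg_ae (Filter.Eventually.of_forall fun ξ => by positivity) hm]
    rfl

/-- Cauchy–Schwarz bound for the weighted `L¹` norm of the Fourier transform. -/
theorem integral_weighted_fourierHatL2_le {d : ℕ} {r t : ℝ} (hrt : (d : ℝ) / 2 < r - t)
    {f : Space d → ℂ} (hf : MemSobolev r f) :
    Integrable (fun ξ => ‖fourierHatL2 f ξ‖ * (1 + ‖ξ‖ ^ 2) ^ (t / 2)) ∧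
    ∫ ξ, ‖fourierHatL2 f ξ‖ * (1 + ‖ξ‖ ^ 2) ^ (t / 2) ≤
      √(∫ ξ : Space d, (1 + ‖ξ‖ ^ 2) ^ (t - r)) * √(sobolevEnergy r f).toReal := by
  obtain ⟨h1, h2⟩ := memLp_weighted_fourierHatL2 hf
  have hsq : ∀ ξ : Space d, ((1 + ‖ξ‖ ^ 2 : ℝ) ^ ((t - r) / 2)) ^ 2
      = (1 + ‖ξ‖ ^ 2) ^ (t - r) := fun ξ => by
    rw [← Real.rpow_mul_natCast (by positivity)]
    congr 1
    push_cast
    ring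
  have hv : MemLp (fun ξ : Space d => (1 + ‖ξ‖ ^ 2 : ℝ) ^ ((t - r) / 2)) 2 volume := by
    refine (memLp_two_iff_integrable_sq (Continuous.rpow_const (by fun_prop)
      fun ξ => Or.inl (by positivity)).aestronglyMeasurable).2 ?_
    simp_rw [hsq]
    -- The weight is integrable because `2 (r - t) > d`.
    have := integrable_rpow_neg_one_add_norm_sq (E := Space d) (μ := volume) (r := 2 * (r - t))
      (by simp; linarith)
    refine this.congr (Filter.Eventually.of_forall fun ξ => ?_)
    simp only
    congr 1
    ring
  have hprod : ∀ ξ : Space d, ‖fourierHatL2 f ξ‖ * (1 + ‖ξ‖ ^ 2) ^ (t / 2) =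
      (1 + ‖ξ‖ ^ 2 : ℝ) ^ ((t - r) / 2) * (‖fourierHatL2 f ξ‖ * (1 + ‖ξ‖ ^ 2) ^ (r / 2)) :=
    fun ξ => by
    rw [mul_left_comm, ← Real.rpow_add (by positivity)]
    congr 2
    ring
  simp_rw [hprod]
  refine ⟨hv.integrable_mul h1, ?_⟩
  have := integral_mul_le_Lp_mul_Lq_of_nonneg (μ := (volume : Measure (Space d)))
    Real.HolderConjugate.two_two
    (Filter.Eventually.of_forall fun ξ : Space d =>
      (by positivity : 0 ≤ (1 + ‖ξ‖ ^ 2 : ℝ) ^ ((t - r) / 2)))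
    (Filter.Eventually.of_forall fun ξ : Space d =>
      (by positivity : 0 ≤ ‖fourierHatL2 f ξ‖ * (1 + ‖ξ‖ ^ 2) ^ (r / 2)))
    (by simpa using hv) (by simpa using h1)
  simp only [Real.rpow_two] at this
  rw [h2] at this
  simp_rw [hsq] at this
  simpa [Real.sqrt_eq_rpow] using this

/-- Fourier inversion for continuous functions of Sobolev order above `d / 2`. -/
theorem eq_integral_fourierHatL2 {d : ℕ} {r : ℝ} (hr : (d : ℝ) / 2 < r) {f : Space d → ℂ}
    (hfc : Continuous f) (hf : MemSobolev r f) (x : Space d) :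
    f x = ((2 * Real.pi) ^ d)⁻¹ •
      ∫ ξ, Complex.exp (Complex.I * (inner ℝ ξ x : ℝ)) * fourierHatL2 f ξ := by
  have hint : Integrable (fourierHatL2 f) := by
    have := (integral_weighted_fourierHatL2_le (t := 0) (by simpa using hr) hf).1
    simp only [zero_div, Real.rpow_zero, mul_one] at this
    exact (integrable_norm_iff (stronglyMeasurable_fourierHatL2 f).aestronglyMeasurable).1 this
  set G : Lp (α := Space d) ℂ 2 volume := 𝓕 (hf.1.toLp f) with hG
  have hpi : (2 * Real.pi) ≠ 0 := by positivity
  have hHG : ∀ ξ, fourierHatL2 f ξ = G ((2 * Real.pi)⁻¹ • ξ) := fourierHatL2_of_memLp hf.1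
  have hGint : Integrable (G : Space d → ℂ) := by
    rw [← integrable_comp_smul_iff volume _ (inv_ne_zero hpi)]
    exact hint.congr (Filter.Eventually.of_forall hHG)
  have hae : f =ᵐ[volume] 𝓕⁻ (G : Space d → ℂ) :=
    hf.1.coeFn_toLp.symm.trans (ae_eq_fourierInv_of_integrable_fourier _ hGint)
  have hcont : Continuous (𝓕⁻ (G : Space d → ℂ)) := by
    rw [Real.fourierInv_eq_fourier_comp_neg]
    exact VectorFourier.fourierIntegral_continuous Real.continuous_fourierChar
      continuous_inner hGint.comp_neg
  have hfx := congrFun ((Continuous.ae_eq_iff_eq volume hfc hcont).1 hae) x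
  rw [Real.fourierInv_eq'] at hfx
  rw [hfx]
  -- The substitution `ξ = 2πη` turns Mathlib's kernel into `e^{i x·ξ}` and produces the factor
  -- `(2π)^{-d}`.
  have := Measure.integral_comp_inv_smul (μ := (volume : Measure (Space d)))
    (fun η => Complex.exp (↑(2 * Real.pi * inner ℝ η x) * Complex.I) • G η) (2 * Real.pi)
  simp only [finrank_euclideanSpace, Fintype.card_fin] at this
  rw [abs_of_pos (by positivity)] at this
  rw [← inv_smul_eq_iff₀ (by positivity)] at this
  rw [← this]
  congr 2
  ext ξ
  rw [hHG, smul_eq_mul, inner_smul_left]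
  congr 2
  simp only [conj_trivial]
  rw [mul_inv_cancel_left₀ hpi, mul_comm]

/-- Interpolates between the Lipschitz bound `c`, used for `c ≤ 1`, and the trivial bound `2`, used
for `c ≥ 1`. -/
theorem norm_exp_sub_exp_le {ζ : ℝ} (hζ0 : 0 ≤ ζ) (hζ1 : ζ ≤ 1) (a b c : ℝ) (h : |a - b| ≤ c) :
    ‖Complex.exp (Complex.I * a) - Complex.exp (Complex.I * b)‖ ≤ 2 * c ^ ζ := by
  have hc : 0 ≤ c := (abs_nonneg _).trans h
  have h1 : ‖Complex.exp (Complex.I * a) - Complex.exp (Complex.I * b)‖ ≤ |a - b| := by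
    have : Complex.exp (Complex.I * a) - Complex.exp (Complex.I * b) =
        Complex.exp (Complex.I * b) * (Complex.exp (Complex.I * ((a - b : ℝ) : ℂ)) - 1) := by
      rw [mul_sub, ← Complex.exp_add]
      push_cast
      ring_nf
    rw [this, norm_mul, Complex.norm_exp_I_mul_ofReal, one_mul]
    simpa using Real.norm_exp_I_mul_ofReal_sub_one_le (x := a - b)
  rcases le_total c 1 with hc1 | hc1
  · calc _ ≤ c := h1.trans h
      _ = c ^ (1 : ℝ) := (Real.rpow_one c).symm
      _ ≤ c ^ ζ := Real.rpow_le_rpow_of_exponent_ge' hc hc1 hζ0 hζ1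
      _ ≤ 2 * c ^ ζ := by linarith [Real.rpow_nonneg hc ζ]
  · calc _ ≤ ‖Complex.exp (Complex.I * a)‖ + ‖Complex.exp (Complex.I * b)‖ := norm_sub_le _ _
      _ = 2 := by rw [Complex.norm_exp_I_mul_ofReal, Complex.norm_exp_I_mul_ofReal]; norm_num
      _ ≤ 2 * c ^ ζ := by linarith [Real.one_le_rpow hc1 hζ0]

/-- The Sobolev embedding into bounded Hölder functions. -/
theorem exists_sobolev_embedding {d : ℕ} {s r ζ : ℝ} (hs : (d : ℝ) / 2 < s) (hζ0 : 0 ≤ ζ)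
    (hζ1 : ζ ≤ 1) (hζ : ζ ≤ r - s) :
    ∃ K : ℝ, 0 < K ∧ ∀ f : Space d → ℂ, Continuous f → MemSobolev r f →
      (∀ x, ‖f x‖ ≤ K * sobolevNorm r f) ∧
      ∀ x y, ‖f x - f y‖ ≤ K * sobolevNorm r f * ‖x - y‖ ^ ζ := by
  set J : ℝ := √(∫ ξ : Space d, (1 + ‖ξ‖ ^ 2) ^ (ζ - r)) with hJ
  set p : ℝ := (2 * Real.pi) ^ (-((d : ℝ) / 2)) with hp
  have hp0 : 0 < p := by positivity
  -- One factor `p` of the inversion constant is the normalization inside `sobolevNorm`; the other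
  -- goes into `K`.
  have hpp : ((2 * Real.pi) ^ d)⁻¹ = p * p := by
    rw [hp, ← Real.rpow_add (by positivity), ← Real.rpow_natCast, ← Real.rpow_neg (by positivity)]
    congr 1
    ring
  have hJ0 : 0 ≤ J := Real.sqrt_nonneg _
  -- The factor `2` comes from `norm_exp_sub_exp_le`; the `1` only secures positivity.
  refine ⟨2 * p * J + 1, by positivity, fun f hfc hf => ?_⟩
  obtain ⟨hi, hle⟩ := integral_weighted_fourierHatL2_le (t := ζ) (by linarith) hf
  set E : ℝ := √(sobolevEnergy r f).toReal with hE
  have hE0 : 0 ≤ E := Real.sqrt_nonneg _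
  have hA : sobolevNorm r f = p * E := rfl
  have hr : (d : ℝ) / 2 < r := by linarith
  have hone : ∀ ξ : Space d, (1 : ℝ) ≤ (1 + ‖ξ‖ ^ 2) ^ (ζ / 2) := fun ξ =>
    Real.one_le_rpow (by nlinarith [sq_nonneg ‖ξ‖]) (by linarith)
  have hmeas : ∀ x : Space d, AEStronglyMeasurable
      (fun ξ => Complex.exp (Complex.I * (inner ℝ ξ x : ℝ)) * fourierHatL2 f ξ) volume := fun x =>
    (by fun_prop : Continuous fun ξ : Space d => Complex.exp (Complex.I * (inner ℝ ξ x : ℝ))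
      ).aestronglyMeasurable.mul (stronglyMeasurable_fourierHatL2 f).aestronglyMeasurable
  have hint : ∀ x : Space d, Integrable
      (fun ξ => Complex.exp (Complex.I * (inner ℝ ξ x : ℝ)) * fourierHatL2 f ξ) := fun x => by
    refine hi.mono' (hmeas x) (Filter.Eventually.of_forall fun ξ => ?_)
    rw [norm_mul, Complex.norm_exp_I_mul_ofReal, one_mul]
    exact le_mul_of_one_le_right (norm_nonneg _) (hone ξ)
  constructor
  · intro x
    rw [eq_integral_fourierHatL2 hr hfc hf x, norm_smul, hpp, Real.norm_of_nonneg (by positivity)]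
    have h1 : ‖∫ ξ, Complex.exp (Complex.I * (inner ℝ ξ x : ℝ)) * fourierHatL2 f ξ‖ ≤ J * E := by
      refine (norm_integral_le_of_norm_le hi (Filter.Eventually.of_forall fun ξ => ?_)).trans hle
      rw [norm_mul, Complex.norm_exp_I_mul_ofReal, one_mul]
      exact le_mul_of_one_le_right (norm_nonneg _) (hone ξ)
    rw [hA]
    have : 0 ≤ p * p * (J * E) := by positivity
    have h3 : 0 ≤ p * E := by positivity
    nlinarith [mul_le_mul_of_nonneg_left h1 (by positivity : 0 ≤ p * p)]
  · intro x y
    rw [eq_integral_fourierHatL2 hr hfc hf x, eq_integral_fourierHatL2 hr hfc hf y, ← smul_sub,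
      ← integral_sub (hint x) (hint y), norm_smul, hpp, Real.norm_of_nonneg (by positivity)]
    have h1 : ‖∫ ξ, (Complex.exp (Complex.I * (inner ℝ ξ x : ℝ)) * fourierHatL2 f ξ -
        Complex.exp (Complex.I * (inner ℝ ξ y : ℝ)) * fourierHatL2 f ξ)‖ ≤
        2 * ‖x - y‖ ^ ζ * (J * E) := by
      refine (norm_integral_le_of_norm_le (hi.const_mul (2 * ‖x - y‖ ^ ζ))
        (Filter.Eventually.of_forall fun ξ => ?_)).trans ?_
      · rw [← sub_mul, norm_mul]
        have hb := norm_exp_sub_exp_le hζ0 hζ1 (inner ℝ ξ x) (inner ℝ ξ y) (‖ξ‖ * ‖x - y‖)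
          (by rw [← inner_sub_right]; exact abs_real_inner_le_norm _ _)
        have hw : ‖ξ‖ ^ ζ ≤ (1 + ‖ξ‖ ^ 2) ^ (ζ / 2) := by
          have : ‖ξ‖ ^ ζ = (‖ξ‖ ^ 2) ^ (ζ / 2) := by
            rw [← Real.rpow_natCast_mul (norm_nonneg _)]
            congr 1
            push_cast
            ring
          rw [this]
          exact Real.rpow_le_rpow (by positivity) (by linarith) (by linarith)
        rw [Real.mul_rpow (norm_nonneg _) (norm_nonneg _)] at hb
        have hxy : 0 ≤ ‖x - y‖ ^ ζ := by positivity
        calc _ ≤ (2 * (‖ξ‖ ^ ζ * ‖x - y‖ ^ ζ)) * ‖fourierHatL2 f ξ‖ := by gcongr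
          _ ≤ (2 * ((1 + ‖ξ‖ ^ 2) ^ (ζ / 2) * ‖x - y‖ ^ ζ)) * ‖fourierHatL2 f ξ‖ := by gcongr
          _ = _ := by ring
      · rw [integral_const_mul]
        gcongr
    rw [hA]
    have h3 : 0 ≤ p * E * ‖x - y‖ ^ ζ := by positivity
    nlinarith [mul_le_mul_of_nonneg_left h1 (by positivity : 0 ≤ p * p)]

/-! ### Sum rules and the partition of unity. -/

/-- The Fourier transform of a refinable function with sum rules vanishes on `2πℤ^d \ {0}`. -/
theorem IsRefinable.fourierHat_eq_zero {d : ℕ} {φ a : Space d → ℂ} (h : IsRefinable φ a) {m : ℕ}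
    (ha : HasSumRules a (m + 1)) (k : Fin d → ℤ) (hk : k ≠ 0) :
    fourierHat φ ((2 * Real.pi) • latticePt k) = 0 := by
  -- Induction on the `ℓ¹` norm of `k`: an odd coordinate lets a sum rule annihilate the mask at
  -- `πk`; otherwise `k = 2l`, and the claim passes to the smaller `l`.
  induction hn : ∑ i, (k i).natAbs using Nat.strong_induction_on generalizing k with
  | _ n ih =>
  have hhalf : (2 * Real.pi) • latticePt k =
      (2 : ℝ) • ((2 * Real.pi) • ((2 : ℝ)⁻¹ • latticePt k)) := by
    simp only [smul_smul]
    congr 1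
    ring
  rw [hhalf, h.refinement]
  by_cases hodd : ∃ i, Odd (k i)
  · have hzero := (ha k hodd).eq_zero_imp.self_of_nhds (by simp)
    rw [zero_add] at hzero
    rw [hzero, zero_mul]
  · push Not at hodd
    simp only [Int.not_odd_iff_even] at hodd
    choose l hl using fun i => (hodd i).two_dvd
    have hkl : (2 : ℝ)⁻¹ • latticePt k = latticePt l := by
      ext i
      simp [latticePt, hl i]
    obtain ⟨i, hi⟩ := Function.ne_iff.1 hk
    rw [hkl, ih (∑ i, (l i).natAbs) ?_ l ?_ rfl, mul_zero]
    · rw [← hn]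
      refine Finset.sum_lt_sum (fun j _ => ?_) ⟨i, Finset.mem_univ i, ?_⟩
      · rw [hl j, Int.natAbs_mul]
        norm_num
        omega
      · have := hl i
        simp only [Pi.zero_apply] at hi
        omega
    · rintro rfl
      exact hi (by simp [hl i])

/-- The projection of `ℝ^d` onto the torus `ℝ^d / ℤ^d`. -/
def torusMk {d : ℕ} (x : Space d) : UnitAddTorus (Fin d) := fun i => (x i : UnitAddCircle)

theorem continuous_torusMk {d : ℕ} : Continuous (torusMk (d := d)) :=
  continuous_pi fun i => (AddCircle.continuous_mk' 1).comp (by fun_prop)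

/-- A finite measure on the torus is determined by its Fourier coefficients. -/
theorem torus_measure_ext {d : ℕ} {μ ν : Measure (UnitAddTorus (Fin d))} [IsFiniteMeasure μ]
    [IsFiniteMeasure ν]
    (h : ∀ n, ∫ x, UnitAddTorus.mFourier n x ∂μ = ∫ x, UnitAddTorus.mFourier n x ∂ν) :
    μ = ν := by
  have hcont : ∀ (ρ : Measure (UnitAddTorus (Fin d))) [IsFiniteMeasure ρ],
      Continuous fun F : C(UnitAddTorus (Fin d), ℂ) => ∫ x, F x ∂ρ := fun ρ _ => by
    have h1 : Continuous fun F : C(UnitAddTorus (Fin d), ℂ) =>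
        ∫ x, (ContinuousMap.toLp (E := ℂ) 1 ρ ℂ F) x ∂ρ :=
      continuous_integral.comp (ContinuousMap.toLp (E := ℂ) 1 ρ ℂ).continuous
    exact h1.congr fun F => integral_congr_ae (ContinuousMap.coeFn_toLp ρ F)
  have hint : ∀ (ρ : Measure (UnitAddTorus (Fin d))) [IsFiniteMeasure ρ]
      (F : C(UnitAddTorus (Fin d), ℂ)), Integrable F ρ := fun ρ _ F =>
    (F.continuous.integrable_of_hasCompactSupport (HasCompactSupport.of_compactSpace _))
  have hall : ∀ F : C(UnitAddTorus (Fin d), ℂ), ∫ x, F x ∂μ = ∫ x, F x ∂ν := by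
    -- The functions with equal integrals form a closed subspace containing the characters, whose
    -- span is dense.
    let K : Submodule ℂ C(UnitAddTorus (Fin d), ℂ) :=
      { carrier := {F | ∫ x, F x ∂μ = ∫ x, F x ∂ν}
        zero_mem' := by simp
        add_mem' := fun {F G} hF hG => by
          simp only [Set.mem_ofPred_eq, ContinuousMap.add_apply] at *
          rw [integral_add (hint μ F) (hint μ G), integral_add (hint ν F) (hint ν G), hF, hG]
        smul_mem' := fun c F hF => by
          simp only [Set.mem_ofPred_eq, ContinuousMap.smul_apply] at *
          rw [integral_smul, integral_smul, hF] }
    have hK : (⊤ : Submodule ℂ C(UnitAddTorus (Fin d), ℂ)) ≤ K := by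
      rw [← UnitAddTorus.span_mFourier_closure_eq_top]
      refine Submodule.topologicalClosure_minimal _ (Submodule.span_le.2 ?_)
        (isClosed_eq (hcont μ) (hcont ν))
      rintro _ ⟨n, rfl⟩
      exact h n
    exact fun F => hK trivial
  refine ext_of_forall_integral_eq_of_IsFiniteMeasure fun f => ?_
  have := hall ⟨fun x => (f x : ℂ), by fun_prop⟩
  simp only [ContinuousMap.coe_mk, integral_complex_ofReal] at this
  exact_mod_cast this

/-- Links Fourier coefficients on the torus to `fourierHat` on the lattice; opposite sign
conventions account for `-n`. -/
theorem mFourier_torusMk {d : ℕ} (n : Fin d → ℤ) (x : Space d) :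
    UnitAddTorus.mFourier n (torusMk x) =
      Complex.exp (-(Complex.I * ((inner ℝ x ((2 * Real.pi) • latticePt (-n)) : ℝ) : ℂ))) := by
  simp only [UnitAddTorus.mFourier, torusMk, ContinuousMap.coe_mk, fourier_coe_apply]
  rw [← Complex.exp_sum]
  congr 1
  simp only [latticePt, PiLp.inner_apply, inner_smul_right]
  simp [Finset.mul_sum]
  refine Finset.sum_congr rfl fun i _ => ?_
  ring

/-- The half-open unit cube with lower corner `b`. -/
def unitCube {d : ℕ} (b : Fin d → ℝ) : Set (Space d) := {x | ∀ i, x i ∈ Set.Ioc (b i) (b i + 1)}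

theorem measurableSet_unitCube {d : ℕ} (b : Fin d → ℝ) : MeasurableSet (unitCube b) := by
  have : unitCube b = ⋂ i, (fun x : Space d => x i) ⁻¹' Set.Ioc (b i) (b i + 1) := by
    ext; simp [unitCube]
  rw [this]
  exact MeasurableSet.iInter fun i => (by fun_prop : Measurable fun x : Space d => x i)
    measurableSet_Ioc

/-- The cube is a fundamental domain of the torus, where the characters are orthonormal. -/
theorem setIntegral_unitCube_mFourier {d : ℕ} (b : Fin d → ℝ) (n : Fin d → ℤ) :
    ∫ x in unitCube b, UnitAddTorus.mFourier n (torusMk x) = if n = 0 then 1 else 0 := by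
  have h1 : ∫ x in unitCube b, UnitAddTorus.mFourier n (torusMk x) =
      ∫ y in {y : Fin d → ℝ | ∀ i, y i ∈ Set.Ioc (b i) (b i + 1)},
        UnitAddTorus.mFourier n (fun i => (y i : UnitAddCircle)) :=
    (PiLp.volume_preserving_ofLp (Fin d)).setIntegral_preimage_emb
      (MeasurableEquiv.toLp 2 (Fin d → ℝ)).symm.measurableEmbedding
      (fun y => UnitAddTorus.mFourier n (fun i => (y i : UnitAddCircle)))
      {y : Fin d → ℝ | ∀ i, y i ∈ Set.Ioc (b i) (b i + 1)}
  rw [h1, ← UnitAddTorus.integral_preimage (fun y => UnitAddTorus.mFourier n y) b]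
  have h2 := orthonormal_iff_ite.1 (UnitAddTorus.orthonormal_mFourier (d := Fin d)) 0 n
  rw [ContinuousMap.inner_toLp] at h2
  simp only [UnitAddTorus.mFourier_zero, ContinuousMap.one_apply, map_one, mul_one] at h2
  simpa [eq_comm] using h2

theorem injOn_torusMk {d : ℕ} (b : Fin d → ℝ) : Set.InjOn torusMk (unitCube b) := by
  intro x hx y hy hxy
  ext i
  have h := congrFun hxy i
  exact (AddCircle.coe_eq_coe_iff_of_mem_Ioc (hx i) (hy i)).1 h

theorem torusMk_eq_iff {d : ℕ} {x y : Space d} :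
    torusMk x = torusMk y ↔ ∃ k : Fin d → ℤ, x + latticePt k = y := by
  constructor
  · intro h
    have h1 : ∀ i, ∃ m : ℤ, x i + m = y i := fun i => by
      have := QuotientAddGroup.eq.1 (congrFun h i)
      obtain ⟨m, hm⟩ := AddSubgroup.mem_zmultiples_iff.1 this
      refine ⟨m, ?_⟩
      simp only [zsmul_eq_mul, mul_one] at hm
      rw [hm]
      ring
    choose k hk using h1
    refine ⟨k, ?_⟩
    ext i
    simpa [latticePt] using hk i
  · rintro ⟨k, rfl⟩
    funext i
    refine QuotientAddGroup.eq.2 (AddSubgroup.mem_zmultiples_iff.2 ⟨k i, ?_⟩)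
    simp [latticePt]

theorem latticePt_injective {d : ℕ} : Function.Injective (latticePt (d := d)) := by
  intro k l h
  funext i
  have := congrArg (fun x : Space d => x i) h
  simpa [latticePt] using this

/-- The projection to the torus of a density whose Fourier transform vanishes on
`2πℤ^d \ {0}` is the Haar measure. -/
theorem map_torusMk_withDensity {d : ℕ} {φ : Space d → ℝ} (hφ0 : ∀ x, 0 ≤ φ x)
    (hφi : Integrable φ) (hone : fourierHat (fun x => (φ x : ℂ)) 0 = 1)
    (hzero : ∀ k : Fin d → ℤ, k ≠ 0 →
      fourierHat (fun x => (φ x : ℂ)) ((2 * Real.pi) • latticePt k) = 0) (b : Fin d → ℝ) :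
    (volume.withDensity fun x => ENNReal.ofReal (φ x)).map torusMk =
      (volume.restrict (unitCube b)).map torusMk := by
  have hfin : IsFiniteMeasure (volume.withDensity fun x => ENNReal.ofReal (φ x)) :=
    isFiniteMeasure_withDensity_ofReal hφi.2
  have hcube : IsFiniteMeasure ((volume : Measure (Space d)).restrict (unitCube b)) := by
    refine isFiniteMeasure_restrict.2 (Bornology.IsBounded.measure_lt_top ?_).ne
    refine (Metric.isBounded_closedBall (x := (0 : Space d))
      (r := √(∑ i, (|b i| + 1) ^ 2))).subset fun x hx => ?_
    rw [mem_closedBall_zero_iff, EuclideanSpace.norm_eq]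
    refine Real.sqrt_le_sqrt (Finset.sum_le_sum fun i _ => ?_)
    have := hx i
    gcongr
    rw [Real.norm_eq_abs, abs_le]
    constructor <;> cases abs_cases (b i) <;> linarith [this.1, this.2]
  refine torus_measure_ext fun n => ?_
  rw [integral_map continuous_torusMk.aemeasurable
      (ContinuousMap.continuous _).aestronglyMeasurable,
    integral_map continuous_torusMk.aemeasurable
      (ContinuousMap.continuous _).aestronglyMeasurable, setIntegral_unitCube_mFourier,
    integral_withDensity_eq_integral_toReal_smul₀ hφi.1.aemeasurable.ennreal_ofReal
      (Filter.Eventually.of_forall fun x => ENNReal.ofReal_lt_top)]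
  have : ∫ x, (ENNReal.ofReal (φ x)).toReal • UnitAddTorus.mFourier n (torusMk x) =
      fourierHat (fun x => (φ x : ℂ)) ((2 * Real.pi) • latticePt (-n)) := by
    unfold fourierHat
    congr 1
    ext x
    rw [ENNReal.toReal_ofReal (hφ0 x), mFourier_torusMk, Complex.real_smul]
  rw [this]
  split_ifs with hn
  · have h0 : (2 * Real.pi) • latticePt (-n) = 0 := by
      ext i
      simp [latticePt, hn]
    rw [h0, hone]
  · exact hzero _ (neg_ne_zero.2 hn)

/-- The integer translates of a nonnegative integrable function whose Fourier transform is `1`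
at `0` and vanishes on `2πℤ^d \ {0}` form a partition of unity. -/
theorem ae_tsum_translates_eq_one {d : ℕ} {φ : Space d → ℝ} (hφ0 : ∀ x, 0 ≤ φ x)
    (hφi : Integrable φ) (hone : fourierHat (fun x => (φ x : ℂ)) 0 = 1)
    (hzero : ∀ k : Fin d → ℤ, k ≠ 0 →
      fourierHat (fun x => (φ x : ℂ)) ((2 * Real.pi) • latticePt k) = 0) :
    ∀ᵐ x : Space d, ∑' k : Fin d → ℤ, ENNReal.ofReal (φ (x - latticePt k)) = 1 := by
  have hmeas : ∀ k : Fin d → ℤ, AEMeasurable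
      (fun x => ENNReal.ofReal (φ (x - latticePt k))) volume := fun k =>
    (hφi.comp_sub_right (latticePt k)).1.aemeasurable.ennreal_ofReal
  -- For `B` inside the cube, the preimage of `torusMk '' B` is the disjoint union of the integer
  -- translates of `B`. Equality of the two pushforwards on this image says that the periodized `φ`
  -- has integral `volume B` over `B`.
  have hcube : ∀ b : Fin d → ℝ, ∀ᵐ x ∂(volume.restrict (unitCube b)),
      ∑' k : Fin d → ℤ, ENNReal.ofReal (φ (x - latticePt k)) = 1 := fun b => by
    refine ae_eq_of_forall_setLIntegral_eq_of_sigmaFinite₀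
      (AEMeasurable.tsum fun k => (hmeas k).restrict) aemeasurable_const fun s hs _ => ?_
    rw [Measure.restrict_restrict hs]
    set B := s ∩ unitCube b with hBdef
    have hB : MeasurableSet B := hs.inter (measurableSet_unitCube b)
    have hBQ : B ⊆ unitCube b := Set.inter_subset_right
    have hinj : Set.InjOn torusMk B := (injOn_torusMk b).mono hBQ
    have himg : MeasurableSet (torusMk '' B) :=
      hB.image_of_continuousOn_injOn continuous_torusMk.continuousOn hinj
    have heq := congrArg (fun μ => μ (torusMk '' B)) (map_torusMk_withDensity hφ0 hφi hone hzero b)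
    rw [Measure.map_apply continuous_torusMk.measurable himg,
      Measure.map_apply continuous_torusMk.measurable himg,
      Measure.restrict_apply (continuous_torusMk.measurable himg)] at heq
    have h1 : torusMk ⁻¹' (torusMk '' B) ∩ unitCube b = B := by
      ext x
      constructor
      · rintro ⟨⟨y, hy, hyx⟩, hx⟩
        rwa [← injOn_torusMk b (hBQ hy) hx hyx]
      · exact fun hx => ⟨⟨x, hx, rfl⟩, hBQ hx⟩
    have h2 : torusMk ⁻¹' (torusMk '' B) = ⋃ k : Fin d → ℤ, (fun x => x + latticePt k) ⁻¹' B := by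
      ext x
      simp only [Set.mem_preimage, Set.mem_image, Set.mem_iUnion]
      constructor
      · rintro ⟨y, hy, hyx⟩
        obtain ⟨k, rfl⟩ := torusMk_eq_iff.1 hyx.symm
        exact ⟨k, hy⟩
      · rintro ⟨k, hk⟩
        exact ⟨_, hk, (torusMk_eq_iff.2 ⟨k, rfl⟩).symm⟩
    have hdisj : Pairwise (Function.onFun Disjoint
        fun k : Fin d → ℤ => (fun x => x + latticePt k) ⁻¹' B) := fun k l hkl => by
      refine Set.disjoint_left.2 fun x hx hx' => hkl ?_
      have := hinj hx hx' ((torusMk_eq_iff.2 ⟨k, rfl⟩).symm.trans (torusMk_eq_iff.2 ⟨l, rfl⟩))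
      exact latticePt_injective (add_left_cancel this)
    have hpre : ∀ k : Fin d → ℤ, MeasurableSet ((fun x => x + latticePt k) ⁻¹' B) := fun k =>
      measurable_add_const _ hB
    rw [h1, h2, measure_iUnion hdisj hpre] at heq
    rw [lintegral_tsum fun k => (hmeas k).restrict, setLIntegral_const, one_mul, ← heq]
    refine tsum_congr fun k => ?_
    rw [withDensity_apply _ (hpre k)]
    have := (measurePreserving_add_right volume (latticePt k)).setLIntegral_comp_preimage_emb
      (measurableEmbedding_addRight _) (fun x => ENNReal.ofReal (φ (x - latticePt k))) B
    simpa using this.symm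
  have hall : ∀ᵐ x : Space d, ∀ b : Fin d → ℤ, x ∈ unitCube (fun i => (b i : ℝ)) →
      ∑' k : Fin d → ℤ, ENNReal.ofReal (φ (x - latticePt k)) = 1 :=
    ae_all_iff.2 fun b => (ae_restrict_iff' (measurableSet_unitCube _)).1 (hcube _)
  filter_upwards [hall] with x hx
  -- The cubes are open below and closed above, whence `⌈x i⌉ - 1` rather than the floor.
  refine hx (fun i => ⌈x i⌉ - 1) fun i => ?_
  push_cast
  constructor <;> linarith [Int.le_ceil (x i), Int.ceil_lt_add_one (x i)]

theorem ae_tsum_dilated_translates_eq_one {d : ℕ} {φ : Space d → ℝ}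
    (h : ∀ᵐ x : Space d, ∑' k : Fin d → ℤ, ENNReal.ofReal (φ (x - latticePt k)) = 1)
    {c : ℝ} (hc : c ≠ 0) :
    ∀ᵐ x : Space d, ∑' k : Fin d → ℤ, ENNReal.ofReal (φ (c • x - latticePt k)) = 1 := by
  have : Measure.QuasiMeasurePreserving (fun x : Space d => c • x) volume volume := by
    refine ⟨measurable_const_smul c, ?_⟩
    rw [Measure.map_addHaar_smul _ hc]
    exact Measure.smul_absolutelyContinuous
  exact this.ae h

/-! ### Recovering samples from intensities. -/

/-- The difference of two interference intensities, up to the term linear in `w`, for reference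
values of equal modulus. -/
theorem abs_intensity_sub_le {z z' w w' : ℂ} {α D F : ℝ} (hz : ‖z‖ = α) (hz' : ‖z'‖ = α)
    (hw : ‖w‖ ≤ F) (hw' : ‖w'‖ ≤ F) (hD : ‖w - w'‖ ≤ D) :
    |‖w + z‖ ^ 2 - ‖w' + z'‖ ^ 2 - 2 * (w.re * (z - z').re + w.im * (z - z').im)| ≤
      2 * D * (F + α) := by
  have hα : 0 ≤ α := hz ▸ norm_nonneg z
  have hF : 0 ≤ F := (norm_nonneg w).trans hw
  -- Equal moduli cancel the intensities of the reference wave; only terms containing `w - w'`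
  -- survive in `h1`.
  have hzz : z.re * z.re + z.im * z.im = z'.re * z'.re + z'.im * z'.im := by
    rw [← Complex.normSq_apply, ← Complex.normSq_apply, Complex.normSq_eq_norm_sq,
      Complex.normSq_eq_norm_sq, hz, hz']
  have h1 : ‖w + z‖ ^ 2 - ‖w' + z'‖ ^ 2 - 2 * (w.re * (z - z').re + w.im * (z - z').im) =
      (‖w‖ - ‖w'‖) * (‖w‖ + ‖w'‖) + 2 * ((w - w') * starRingEnd ℂ z').re := by
    have h2 : (‖w‖ - ‖w'‖) * (‖w‖ + ‖w'‖) = ‖w‖ ^ 2 - ‖w'‖ ^ 2 := by ring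
    rw [h2]
    simp only [← Complex.normSq_eq_norm_sq, Complex.normSq_apply, Complex.add_re, Complex.add_im,
      Complex.sub_re, Complex.sub_im, Complex.mul_re, Complex.conj_re, Complex.conj_im]
    linear_combination hzz
  rw [h1]
  have h3 : |(‖w‖ - ‖w'‖) * (‖w‖ + ‖w'‖)| ≤ D * (F + F) := by
    rw [abs_mul, abs_of_nonneg (by positivity : 0 ≤ ‖w‖ + ‖w'‖)]
    have := (abs_norm_sub_norm_le w w').trans hD
    have hD0 : 0 ≤ D := (norm_nonneg _).trans hD
    gcongr
  have h4 : |((w - w') * starRingEnd ℂ z').re| ≤ D * α := by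
    refine (Complex.abs_re_le_norm _).trans ?_
    rw [norm_mul, RCLike.norm_conj, hz']
    gcongr
  refine (abs_add_le _ _).trans ?_
  rw [abs_mul 2, abs_two]
  linarith

/-- Solving the perturbed linear system for a complex unknown `w`. -/
theorem norm_solve_sub_le {q r w : ℂ} {γ ε u v : ℝ}
    (hμ : (q * starRingEnd ℂ r).im ≠ 0) (hγ : max ‖q‖ ‖r‖ / |(q * starRingEnd ℂ r).im| ≤ γ)
    (hu : |u - 2 * (w.re * q.re + w.im * q.im)| ≤ ε)
    (hv : |v - 2 * (w.re * r.re + w.im * r.im)| ≤ ε) :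
    ‖(⟨(2 * -(q * starRingEnd ℂ r).im)⁻¹ * (r.im * u - q.im * v),
      (2 * -(q * starRingEnd ℂ r).im)⁻¹ * (-r.re * u + q.re * v)⟩ : ℂ) - w‖ ≤ 2 * γ * ε := by
  set m := (q * starRingEnd ℂ r).im with hm
  have hm' : m = q.im * r.re - q.re * r.im := by
    simp only [hm, Complex.mul_im, Complex.conj_re, Complex.conj_im]
    ring
  set ε₁ := u - 2 * (w.re * q.re + w.im * q.im) with hε₁
  set ε₂ := v - 2 * (w.re * r.re + w.im * r.im) with hε₂
  have hε : 0 ≤ ε := (abs_nonneg _).trans hu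
  have h2m : 2 * -m ≠ 0 := by simpa using hμ
  have hmax : max ‖q‖ ‖r‖ ≤ γ * |m| := (div_le_iff₀ (abs_pos.2 hμ)).1 hγ
  -- The entries of the inverse matrix are at most `γ / 2`, so two residuals contribute at most `γ *
  -- ε` to each coordinate.
  have hbound : ∀ s t : ℝ, |s| ≤ max ‖q‖ ‖r‖ → |t| ≤ max ‖q‖ ‖r‖ →
      |(2 * -m)⁻¹ * (s * ε₁ + t * ε₂)| ≤ γ * ε := fun s t hs ht => by
    rw [abs_mul, abs_inv, abs_mul, abs_neg, abs_two, inv_mul_le_iff₀ (by positivity)]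
    calc |s * ε₁ + t * ε₂| ≤ |s| * |ε₁| + |t| * |ε₂| := by
          simpa [abs_mul] using abs_add_le (s * ε₁) (t * ε₂)
      _ ≤ (γ * |m|) * ε + (γ * |m|) * ε := by
          have hγm : 0 ≤ γ * |m| := (abs_nonneg s).trans (hs.trans hmax)
          have := hs.trans hmax
          have := ht.trans hmax
          gcongr
      _ = 2 * |m| * (γ * ε) := by ring
  refine (Complex.norm_le_abs_re_add_abs_im _).trans ?_
  -- The matrix inverts the exact system, so the error is the same matrix applied to the residuals
  -- `ε₁`, `ε₂`.
  have hre : (2 * -m)⁻¹ * (r.im * u - q.im * v) - w.re =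
      (2 * -m)⁻¹ * (r.im * ε₁ + (-q.im) * ε₂) := by
    rw [eq_comm, ← sub_eq_zero]
    field_simp
    rw [hε₁, hε₂, hm']
    ring
  have him : (2 * -m)⁻¹ * (-r.re * u + q.re * v) - w.im =
      (2 * -m)⁻¹ * ((-r.re) * ε₁ + q.re * ε₂) := by
    rw [eq_comm, ← sub_eq_zero]
    field_simp
    rw [hε₁, hε₂, hm']
    ring
  simp only [Complex.sub_re, Complex.sub_im]
  rw [hre, him]
  have h1 := hbound r.im (-q.im) ((Complex.abs_im_le_norm r).trans (le_max_right _ _))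
    (by rw [abs_neg]; exact (Complex.abs_im_le_norm q).trans (le_max_left _ _))
  have h2 := hbound (-r.re) q.re
    (by rw [abs_neg]; exact (Complex.abs_re_le_norm r).trans (le_max_right _ _))
    ((Complex.abs_re_le_norm q).trans (le_max_left _ _))
  linarith

/-- The approximate samples are close to the samples of `f` if `f` varies little between
neighbouring sampling points. -/
theorem norm_planeSample_sub_le {d : ℕ} {f g : Space d → ℂ} {γ α D F : ℝ} {j₀ : Fin d} {N : ℕ}
    {p : Space d} (hg : ∀ x, ‖g x‖ = α) (hf : ∀ x, ‖f x‖ ≤ F)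
    (hD' : ‖f (dilate N p) - f (dilate N (p + basisVec j₀))‖ ≤ D)
    (hD'' : ‖f (dilate N p) - f (dilate N (p - basisVec j₀))‖ ≤ D)
    (hμ : (diffProduct g N p (p + basisVec j₀) (p - basisVec j₀)).im ≠ 0)
    (hγ : max ‖g (dilate N p) - g (dilate N (p + basisVec j₀))‖
        ‖starRingEnd ℂ (g (dilate N p)) - starRingEnd ℂ (g (dilate N (p - basisVec j₀)))‖
      / |(diffProduct g N p (p + basisVec j₀) (p - basisVec j₀)).im| ≤ γ) :
    ‖planeSample g (intensity f g N) j₀ N p - f (dilate N p)‖ ≤ 4 * γ * D * (F + α) := by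
  simp only [diffProduct, ← map_sub, RCLike.norm_conj] at hμ hγ
  have := norm_solve_sub_le hμ hγ
    (abs_intensity_sub_le (hg _) (hg _) (hf _) (hf _) hD')
    (abs_intensity_sub_le (hg _) (hg _) (hf _) (hf _) hD'')
  simp only [planeSample, intensity, diffProduct, ← map_sub]
  exact this.trans_eq (by ring)

/-- An admissibility constant is at least the reciprocal of twice the amplitude. -/
theorem one_le_of_admissible {q r : ℂ} {α γ : ℝ} (hq : ‖q‖ ≤ 2 * α)
    (hμ : (q * starRingEnd ℂ r).im ≠ 0) (hγ : max ‖q‖ ‖r‖ / |(q * starRingEnd ℂ r).im| ≤ γ) :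
    1 ≤ 2 * α * γ := by
  have hr : 0 < ‖r‖ := norm_pos_iff.2 fun h => hμ (by simp [h])
  have hmax : max ‖q‖ ‖r‖ ≤ γ * |(q * starRingEnd ℂ r).im| :=
    (div_le_iff₀ (abs_pos.2 hμ)).1 hγ
  -- One factor of the determinant is at most `2 * α`; the factor `‖r‖` then cancels against the
  -- numerator.
  have him : |(q * starRingEnd ℂ r).im| ≤ 2 * α * ‖r‖ :=
    (Complex.abs_im_le_norm _).trans (by rw [norm_mul, RCLike.norm_conj]; gcongr)
  have hγ0 : 0 ≤ γ := le_trans (by positivity) hγ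
  have h1 : ‖r‖ ≤ γ * (2 * α * ‖r‖) :=
    (le_max_right _ _).trans (hmax.trans (mul_le_mul_of_nonneg_left him hγ0))
  by_contra! hlt
  nlinarith

/-! ### Amplitudes of the waves and the sampling sets. -/

theorem IsPlaneWave.exists_norm_eq {d : ℕ} {g : Space d → ℂ} (hg : IsPlaneWave g) :
    ∃ α : ℝ, 0 < α ∧ ∀ x, ‖g x‖ = α := by
  obtain ⟨α, hα, K, h⟩ := hg
  refine ⟨α, hα, fun x => ?_⟩
  rw [h x, norm_mul, Complex.norm_exp_I_mul_ofReal, mul_one, Complex.norm_of_nonneg hα.le]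

/-- Provides a sampling triple at every level, from which admissibility yields information on the
amplitude. -/
theorem Lam_nonempty {d : ℕ} {Ω : Set (Space d)} {M : Fin d → ℝ} (hΩ : (intPts Ω).Nonempty)
    (hbox : ∀ x ∈ Ω, ∀ l, (Lmin Ω l : ℝ) ≤ x l ∧ x l ≤ (Lmax Ω l : ℝ)) (hM : ∀ l, 0 ≤ M l)
    (N : ℕ) : (Lam Ω M N).Nonempty := by
  obtain ⟨k, hk⟩ := hΩ
  refine ⟨fun l => 2 ^ N * Lmin Ω l, (mem_Lam _ _ _ _).2 fun l => ?_⟩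
  have := hbox _ hk l
  push_cast
  constructor
  · linarith [hM l]
  · gcongr
    exact_mod_cast this.1.trans this.2

/-- A real `sSup` is informative only for bounded sets. The uniform bound at one sampling point
controls the constant modulus of the wave, hence its values on `Ω`. -/
theorem norm_le_waveSup {d : ℕ} {Ω : Set (Space d)} {g : ℕ → Space d → ℂ} {M : Fin d → ℝ}
    {j₀ : Fin d} {γ : ℝ} (hΛ : ∀ N, (Lam Ω M N).Nonempty)
    (hg : ∀ N, 1 ≤ N → IsPlaneWave (g N)) (hadm : IsUniformlyAdmissible g γ (Xi Ω M j₀))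
    {N : ℕ} (hN : 1 ≤ N) {x : Space d} (hx : x ∈ Ω) : ‖g N x‖ ≤ waveSup g Ω := by
  obtain ⟨B, hB⟩ := hadm.bounded
  refine le_csSup ⟨B, ?_⟩ ⟨N, hN, x, hx, rfl⟩
  rintro _ ⟨l, hl, y, -, rfl⟩
  obtain ⟨k, hk⟩ := hΛ l
  obtain ⟨α, -, hα⟩ := (hg l hl).exists_norm_eq
  have := (hB l hl _ _ _ ⟨k, hk, rfl⟩).1
  rw [hα] at this ⊢
  exact this

/-! ### Pointwise error of the reconstruction. -/

/-- If the samples `c k` are within `ε` of `z` wherever the weights do not vanish, then so is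
their weighted mean. -/
theorem norm_sub_weighted_sum_le {ι : Type*} (S : Finset ι) (w : ι → ℝ) (c : ι → ℂ) (z : ℂ)
    {ε : ℝ} (hw : ∀ k ∈ S, 0 ≤ w k) (hsum : ∑ k ∈ S, w k = 1)
    (hc : ∀ k ∈ S, w k ≠ 0 → ‖z - c k‖ ≤ ε) : ‖z - ∑ k ∈ S, c k * (w k : ℂ)‖ ≤ ε := by
  have h1 : z - ∑ k ∈ S, c k * (w k : ℂ) = ∑ k ∈ S, (z - c k) * (w k : ℂ) := by
    simp only [sub_mul, Finset.sum_sub_distrib, ← Finset.mul_sum]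
    rw [← Complex.ofReal_sum, hsum, Complex.ofReal_one, mul_one]
  rw [h1]
  calc _ ≤ ∑ k ∈ S, ε * w k := norm_sum_le_of_le _ fun k hk => by
        rw [norm_mul, Complex.norm_of_nonneg (hw k hk)]
        by_cases h0 : w k = 0
        · simp [h0]
        · exact mul_le_mul_of_nonneg_right (hc k hk h0) (hw k hk)
    _ = ε := by rw [← Finset.mul_sum, hsum, mul_one]

/-- `Lam` is large enough to contain every `k` whose translate is nonzero at a point of `Ω`: the box
for `2^N x` is enlarged below by the support box of `φ`. -/
theorem sum_Lam_eq_one {d : ℕ} {φ : Space d → ℝ} (hφ0 : ∀ x, 0 ≤ φ x) {Ω : Set (Space d)}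
    (hbox : ∀ x ∈ Ω, ∀ l, (Lmin Ω l : ℝ) ≤ x l ∧ x l ≤ (Lmax Ω l : ℝ)) {M : Fin d → ℝ}
    (hM : ∀ x, φ x ≠ 0 → ∀ l, 0 ≤ x l ∧ x l ≤ M l) {N : ℕ} {x : Space d} (hx : x ∈ Ω)
    (hsum : ∑' k : Fin d → ℤ, ENNReal.ofReal (φ ((2 : ℝ) ^ N • x - latticePt k)) = 1) :
    ∑ k ∈ Lam Ω M N, φ ((2 : ℝ) ^ N • x - latticePt k) = 1 := by
  rw [tsum_eq_sum (s := Lam Ω M N), ← ENNReal.ofReal_sum_of_nonneg fun k _ => hφ0 _] at hsum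
  · simpa using hsum
  · intro k hk
    by_contra hne
    refine hk ((mem_Lam _ _ _ _).2 fun l => ?_)
    have h1 := hM _ (fun h => hne (by rw [h, ENNReal.ofReal_zero])) l
    have h2 := hbox x hx l
    have hp : (0 : ℝ) < 2 ^ N := by positivity
    simp only [latticePt, PiLp.sub_apply, PiLp.smul_apply, smul_eq_mul] at h1
    constructor
    · linarith [mul_le_mul_of_nonneg_left h2.1 hp.le]
    · linarith [mul_le_mul_of_nonneg_left h2.2 hp.le]

theorem norm_basisVec {d : ℕ} (j : Fin d) : ‖basisVec j‖ = 1 := by simp [basisVec]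

theorem norm_dilate {d : ℕ} (N : ℕ) (p : Space d) : ‖dilate N p‖ = ((2 : ℝ) ^ N)⁻¹ * ‖p‖ := by
  rw [dilate, norm_smul, Real.norm_of_nonneg (by positivity)]

theorem dilate_sub {d : ℕ} (N : ℕ) (p q : Space d) :
    dilate N p - dilate N q = dilate N (p - q) := (smul_sub _ _ _).symm

theorem dilate_smul {d : ℕ} (N : ℕ) (x : Space d) : dilate N ((2 : ℝ) ^ N • x) = x :=
  inv_smul_smul₀ (by positivity) x

/-- Pointwise error of the reconstruction at the points where the translates of `φ` sum to one. -/
theorem norm_sub_reconstruction_le {d : ℕ} {φ : Space d → ℝ} (hφ0 : ∀ x, 0 ≤ φ x) {R : ℝ}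
    (hR1 : 1 ≤ R) (hR : ∀ x, φ x ≠ 0 → ‖x‖ ≤ R) {Ω : Set (Space d)}
    (hbox : ∀ x ∈ Ω, ∀ l, (Lmin Ω l : ℝ) ≤ x l ∧ x l ≤ (Lmax Ω l : ℝ)) {M : Fin d → ℝ}
    (hM : ∀ x, φ x ≠ 0 → ∀ l, 0 ≤ x l ∧ x l ≤ M l) {j₀ : Fin d} {γ ζ : ℝ} {g f : Space d → ℂ}
    {N : ℕ} (hζ0 : 0 ≤ ζ) (hζ1 : ζ ≤ 1) {α F : ℝ} (hα : ∀ x, ‖g x‖ = α)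
    (hadm : IsAdmissible g γ (Xi Ω M j₀ N) N) (hF : ∀ x, ‖f x‖ ≤ F)
    (hH : ∀ x y, ‖f x - f y‖ ≤ F * ‖x - y‖ ^ ζ) {x : Space d} (hx : x ∈ Ω)
    (hsum : ∑' k : Fin d → ℤ, ENNReal.ofReal (φ ((2 : ℝ) ^ N • x - latticePt k)) = 1) :
    ‖f x - reconstruction φ Ω M j₀ g f N x‖ ≤
      F * (R + 4 * γ * (F + α)) * (((2 : ℝ) ^ N)⁻¹) ^ ζ := by
  have hF0 : 0 ≤ F := (norm_nonneg _).trans (hF 0)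
  refine norm_sub_weighted_sum_le _ _ _ _ (fun k _ => hφ0 _)
    (sum_Lam_eq_one hφ0 hbox hM hx hsum) fun k hk hne => ?_
  set h : ℝ := ((2 : ℝ) ^ N)⁻¹ with hh
  have hh0 : 0 ≤ h := by positivity
  have hstep : ∀ e : Space d, ‖e‖ = 1 → ∀ p q : Space d, p - q = e →
      ‖f (dilate N p) - f (dilate N q)‖ ≤ F * h ^ ζ := fun e he p q hpq => by
    refine (hH _ _).trans_eq ?_
    rw [dilate_sub, norm_dilate, hpq, he, mul_one]
  have hsample := norm_planeSample_sub_le (j₀ := j₀) (p := latticePt k) hα hF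
    (hstep (-basisVec j₀) (by rw [norm_neg, norm_basisVec]) _ _ (by abel))
    (hstep (basisVec j₀) (norm_basisVec _) _ _ (by abel))
    (hadm.im_ne _ _ _ ⟨k, hk, rfl⟩) (hadm.bound _ _ _ ⟨k, hk, rfl⟩)
  have hnear : ‖f x - f (dilate N (latticePt k))‖ ≤ F * (R * h ^ ζ) := by
    have h1 : ‖x - dilate N (latticePt k)‖ ≤ h * R := by
      conv_lhs => rw [← dilate_smul N x]
      rw [dilate_sub, norm_dilate]
      exact mul_le_mul_of_nonneg_left (hR _ hne) hh0
    refine (hH _ _).trans (mul_le_mul_of_nonneg_left ?_ hF0)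
    calc ‖x - dilate N (latticePt k)‖ ^ ζ ≤ (h * R) ^ ζ :=
          Real.rpow_le_rpow (norm_nonneg _) h1 hζ0
      _ = h ^ ζ * R ^ ζ := Real.mul_rpow hh0 (by linarith)
      -- `R ≥ 1` allows `R ^ ζ` to be replaced by `R`, which removes `ζ` from the constant.
      _ ≤ h ^ ζ * R := by
          gcongr
          simpa using Real.rpow_le_rpow_of_exponent_le hR1 hζ1
      _ = R * h ^ ζ := mul_comm _ _
  calc _ ≤ ‖f x - f (dilate N (latticePt k))‖ +
        ‖planeSample g (intensity f g N) j₀ N (latticePt k) - f (dilate N (latticePt k))‖ := by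
        rw [norm_sub_rev (planeSample _ _ _ _ _)]
        exact norm_sub_le_norm_sub_add_norm_sub _ _ _
    _ ≤ F * (R * h ^ ζ) + 4 * γ * (F * h ^ ζ) * (F + α) := add_le_add hnear hsample
    _ = _ := by ring

end SingleShot

end

/-! ### The error bound in `L²(Ω)`. -/

theorem theorem4p4 {d : ℕ} (s ς : ℝ) (hs : (d : ℝ) / 2 < s) (hsς : s < ς)
    (φ : SingleShot.Space d → ℝ) (hφ_nonneg : ∀ x, 0 ≤ φ x)
    (hφ_supp : HasCompactSupport φ)
    (hφ_smooth : (ς : EReal) < SingleShot.smoothnessExponent (fun x => (φ x : ℂ)))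
    (a : SingleShot.Space d → ℂ)
    (hφ_ref : SingleShot.IsRefinable (fun x => (φ x : ℂ)) a)
    (κ : ℕ) (ha : SingleShot.HasSumRules a (κ + 1)) (hκ : ς < (κ : ℝ) + 1) :
    ∃ C : ℝ, 0 < C ∧
      ∀ Ω : Set (SingleShot.Space d), MeasurableSet Ω → Bornology.IsBounded Ω →
        (SingleShot.intPts Ω).Nonempty →
        (∀ x ∈ Ω, ∀ l, (SingleShot.Lmin Ω l : ℝ) ≤ x l ∧ x l ≤ (SingleShot.Lmax Ω l : ℝ)) →
        ∃ C₁ : ℝ, 0 < C₁ ∧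
          ∀ M : Fin d → ℝ, (∀ x, φ x ≠ 0 → ∀ l, 0 ≤ x l ∧ x l ≤ M l) →
          ∀ (j₀ : Fin d) (γ : ℝ) (g : ℕ → SingleShot.Space d → ℂ),
            (∀ N, 1 ≤ N → SingleShot.IsPlaneWave (g N)) →
            SingleShot.IsUniformlyAdmissible g γ (SingleShot.Xi Ω M j₀) →
            ∀ f : SingleShot.Space d → ℂ, Continuous f → SingleShot.MemSobolev ς f →
              ∀ N : ℕ, 1 ≤ N →
                eLpNorm (fun x => f x - SingleShot.reconstruction φ Ω M j₀ (g N) f N x) 2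
                    (volume.restrict Ω) ≤
                  ENNReal.ofReal (SingleShot.sobolevNorm ς f *
                    (C * (2 : ℝ) ^ (-((N : ℝ) * (ς - s) / 2)) +
                      γ * C₁ * (SingleShot.sobolevNorm ς f + SingleShot.waveSup g Ω) *
                        (2 : ℝ) ^ (-(((N : ℝ) + 1) * min 1 (ς - s))))) := by
  set ζ : ℝ := min 1 (ς - s) with hζ
  have hζ0 : 0 ≤ ζ := le_min zero_le_one (by linarith)
  have hζ1 : ζ ≤ 1 := min_le_left _ _
  obtain ⟨K, hK0, hK⟩ := SingleShot.exists_sobolev_embedding (r := ς) hs hζ0 hζ1 (min_le_right _ _)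
  have hone : ∫ x, (φ x : ℂ) = 1 := by
    simpa [SingleShot.fourierHat] using hφ_ref.normalized
  -- The Bochner integral of a non-integrable function is `0`, so an integral equal to `1` gives
  -- integrability.
  have hφi : Integrable φ := by
    have h : Integrable fun x => (φ x : ℂ) :=
      Integrable.of_integral_ne_zero (by rw [hone]; exact one_ne_zero)
    exact h.re
  have hφne : ∃ x, φ x ≠ 0 := by
    by_contra! h
    simp [h] at hone
  have hpart := SingleShot.ae_tsum_translates_eq_one hφ_nonneg hφi hφ_ref.normalized
    fun k hk => hφ_ref.fourierHat_eq_zero ha k hk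
  obtain ⟨R₀, hR₀⟩ := hφ_supp.isCompact.isBounded.exists_norm_le
  set R : ℝ := max 1 R₀ with hRdef
  have hR1 : 1 ≤ R := le_max_left _ _
  have hR : ∀ x, φ x ≠ 0 → ‖x‖ ≤ R := fun x hx =>
    (hR₀ x (subset_tsupport φ hx)).trans (le_max_right _ _)
  -- Any positive `C` serves, since the second term alone dominates the error.
  refine ⟨1, one_pos, fun Ω hΩm hΩb hΩne hbox => ?_⟩
  set V : ℝ := (volume Ω ^ (2 : ℝ)⁻¹).toReal with hV
  have hV0 : 0 ≤ V := ENNReal.toReal_nonneg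
  -- `V` is the square root of the volume of `Ω`, with `1` added for positivity; the factor `2` is
  -- the price of `N + 1` in `hpow`, `K` is the Hölder constant and the last factor comes from `h1`
  -- below.
  refine ⟨(V + 1) * (2 * (K * (2 * R + 4 * K + 4))), by positivity,
    fun M hM j₀ γ g hg hadm f hfc hf N hN => ?_⟩
  obtain ⟨hf1, hf2⟩ := hK f hfc hf
  set A := SingleShot.sobolevNorm ς f with hA
  have hA0 : 0 ≤ A := by rw [hA, SingleShot.sobolevNorm]; positivity
  obtain ⟨x₀, hx₀⟩ := hφne
  have hΛ := SingleShot.Lam_nonempty hΩne hbox fun l => (hM x₀ hx₀ l).1.trans (hM x₀ hx₀ l).2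
  have hadmN := hadm.admissible N hN
  have hγ0 := hadmN.pos
  obtain ⟨α, hα0, hα⟩ := (hg N hN).exists_norm_eq
  have hαW : α ≤ SingleShot.waveSup g Ω := by
    obtain ⟨k, hk⟩ := hΩne
    rw [← hα (SingleShot.latticePt k)]
    exact SingleShot.norm_le_waveSup hΛ hg hadm hN hk
  have hαγ : 1 ≤ 2 * α * γ := by
    obtain ⟨k, hk⟩ := hΛ N
    have hμ := hadmN.im_ne _ _ _ ⟨k, hk, rfl⟩
    have hγ := hadmN.bound _ _ _ ⟨k, hk, rfl⟩
    simp only [SingleShot.diffProduct, ← map_sub, RCLike.norm_conj] at hμ hγ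
    exact SingleShot.one_le_of_admissible
      ((norm_sub_le _ _).trans_eq (by rw [hα, hα]; ring)) hμ hγ
  set W := SingleShot.waveSup g Ω with hW
  set b : ℝ := (2 : ℝ) ^ (-(((N : ℝ) + 1) * ζ)) with hb
  have hb0 : 0 < b := by positivity
  have hpow : (((2 : ℝ) ^ N)⁻¹) ^ ζ ≤ 2 * b := by
    have h1 : (((2 : ℝ) ^ N)⁻¹) ^ ζ = (2 : ℝ) ^ ζ * b := by
      rw [hb, ← Real.rpow_natCast, ← Real.rpow_neg zero_le_two, ← Real.rpow_mul zero_le_two,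
        ← Real.rpow_add zero_lt_two]
      congr 1
      ring
    rw [h1]
    gcongr
    simpa using Real.rpow_le_rpow_of_exponent_le one_le_two hζ1
  set T : ℝ := A * (γ * (2 * (K * (2 * R + 4 * K + 4))) * (A + W) * b) with hT
  have hae : ∀ᵐ x ∂(volume.restrict Ω),
      ‖f x - SingleShot.reconstruction φ Ω M j₀ (g N) f N x‖ ≤ T := by
    filter_upwards [ae_restrict_of_ae (SingleShot.ae_tsum_dilated_translates_eq_one hpart
      (c := (2 : ℝ) ^ N) (by positivity)), ae_restrict_mem hΩm] with x hsum hx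
    refine (SingleShot.norm_sub_reconstruction_le hφ_nonneg hR1 hR hbox hM hζ0 hζ1 hα hadmN
      hf1 hf2 hx hsum).trans ?_
    -- Admissibility gives `1 ≤ 2αγ ≤ 2γW`, so the error `R` caused by interpolating the exact
    -- samples is absorbed into the same term as the error of the approximate samples.
    have h1 : R + 4 * γ * (K * A + α) ≤ γ * ((2 * R + 4 * K + 4) * (A + W)) := by
      have h2 : R ≤ R * (2 * α * γ) := le_mul_of_one_le_right (by linarith) hαγ
      have h3 : 2 * R * α + 4 * (K * A + α) ≤ (2 * R + 4 * K + 4) * (A + W) := by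
        have := mul_le_mul_of_nonneg_left hαW (by linarith : 0 ≤ 2 * R + 4)
        have hRA : 0 ≤ R * A := by positivity
        have hKW : 0 ≤ K * W := mul_nonneg hK0.le (hα0.le.trans hαW)
        linarith
      have := mul_le_mul_of_nonneg_left h3 hγ0.le
      linarith
    have hAW : 0 ≤ A + W := by linarith
    calc K * A * (R + 4 * γ * (K * A + α)) * (((2 : ℝ) ^ N)⁻¹) ^ ζ
        ≤ K * A * (γ * ((2 * R + 4 * K + 4) * (A + W))) * (2 * b) := by gcongr
      _ = T := by rw [hT]; ring
  refine (eLpNorm_le_of_ae_bound hae).trans ?_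
  have hvol : volume Ω ^ (2 : ℝ)⁻¹ ≠ ∞ :=
    ENNReal.rpow_ne_top_of_nonneg (by norm_num) hΩb.measure_lt_top.ne
  rw [Measure.restrict_apply_univ, ENNReal.toReal_ofNat, ← ENNReal.ofReal_toReal hvol,
    ← ENNReal.ofReal_mul hV0]
  refine ENNReal.ofReal_le_ofReal ?_
  have hT0 : 0 ≤ T := by
    have hAW : 0 ≤ A + W := by linarith
    positivity
  -- The first term of the bound is nonnegative and is simply added.
  have h1 : 0 ≤ A * (1 * (2 : ℝ) ^ (-((N : ℝ) * (ς - s) / 2))) := by positivity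
  calc V * T ≤ (V + 1) * T := by linarith
    _ = A * (γ * ((V + 1) * (2 * (K * (2 * R + 4 * K + 4)))) * (A + W) * b) := by rw [hT]; ring
    _ ≤ _ := by rw [mul_add]; linarith
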